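/- Let $E$ be a real Banach space and $a\in E$. Let $C^\infty_a(E)$ be the algebra of germs at $a$ of real-valued functions that are smooth on an open neighbourhood of $a$. An operational tangent vector at $a$ is a linear map $\delta\colon C^\infty_a(E)\to\mathbb R$ with $\delta(fg)=\delta(f)\,g(a)+f(a)\,\delta(g)$ for all $f,g\in C^\infty_a(E)$. For $k\ge 1$ let $L_k(E;\mathbb R)$ be the Banach space of bounded $k$-linear functionals on $E$, and let $f^{(k)}_a\in L_k(E;\mathbb R)$ be the $k$-th differential of $f$ at $a$. For $n\geq 1$, $\delta$ is of order $n$ if there are continuous linear functionals $\ell_k\colon L_k(E;\mathbb R)\to\mathbb R$ $(1\le k\le n)$ such that $\delta f=\sum_{k=1}^n\ell_k(f^{(k)}_a)$ for all $f\in C^\infty_a(E)$, and $\ell_n$ does not vanish identically on the symmetric $n$-linear functionals. Consider the real Banach space $l^p$ of $p$-summable sequences. (i) If $2<p<\infty$, then at no point of $l^p$ is there an operational tangent vector of order $2$. (ii) If $1\le p\le 2$, then at every point of $l^p$ there is a nonzero operational tangent vector of order $2$. -/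

import Mathlib

open Filter Topology
open scoped ENNReal ContDiff

section OperationalTangentVectors

variable {E : Type*} [NormedAddCommGroup E] [NormedSpace ℝ E]

/-- A germ at `a` of real functions is smooth if it has a representative that is `C^∞` on some open
neighbourhood of `a`. -/
def IsSmoothGerm (a : E) (φ : Germ (𝓝 a) ℝ) : Prop :=
  ∃ (f : E → ℝ) (U : Set E), IsOpen U ∧ a ∈ U ∧ ContDiffOn ℝ ∞ f U ∧ φ = (f : Germ (𝓝 a) ℝ)

theorem isSmoothGerm_const (a : E) (c : ℝ) :
    IsSmoothGerm a (((fun _ => c : E → ℝ)) : Germ (𝓝 a) ℝ) :=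
  ⟨fun _ => c, Set.univ, isOpen_univ, Set.mem_univ a, contDiffOn_const, rfl⟩

theorem IsSmoothGerm.add {a : E} {φ ψ : Germ (𝓝 a) ℝ} (hφ : IsSmoothGerm a φ)
    (hψ : IsSmoothGerm a ψ) : IsSmoothGerm a (φ + ψ) := by
  obtain ⟨f, U, hU, haU, hf, rfl⟩ := hφ
  obtain ⟨g, V, hV, haV, hg, rfl⟩ := hψ
  exact ⟨f + g, U ∩ V, hU.inter hV, ⟨haU, haV⟩,
    (hf.mono Set.inter_subset_left).add (hg.mono Set.inter_subset_right), rfl⟩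

theorem IsSmoothGerm.mul {a : E} {φ ψ : Germ (𝓝 a) ℝ} (hφ : IsSmoothGerm a φ)
    (hψ : IsSmoothGerm a ψ) : IsSmoothGerm a (φ * ψ) := by
  obtain ⟨f, U, hU, haU, hf, rfl⟩ := hφ
  obtain ⟨g, V, hV, haV, hg, rfl⟩ := hψ
  exact ⟨f * g, U ∩ V, hU.inter hV, ⟨haU, haV⟩,
    (hf.mono Set.inter_subset_left).mul (hg.mono Set.inter_subset_right), rfl⟩

theorem IsSmoothGerm.smul {a : E} {φ : Germ (𝓝 a) ℝ} (c : ℝ) (hφ : IsSmoothGerm a φ) :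
    IsSmoothGerm a (c • φ) := by
  obtain ⟨f, U, hU, haU, hf, rfl⟩ := hφ
  exact ⟨c • f, U, hU, haU, contDiffOn_const.smul hf, rfl⟩

/-- The real vector space `C^∞_a(E)` of germs at `a` of smooth real functions. -/
def SmoothGerm (a : E) : Submodule ℝ (Germ (𝓝 a) ℝ) where
  carrier := {φ | IsSmoothGerm a φ}
  add_mem' hφ hψ := hφ.add hψ
  zero_mem' := isSmoothGerm_const a 0
  smul_mem' c _ hφ := hφ.smul c

/-- The product of two smooth germs. -/
instance SmoothGerm.instMul (a : E) : Mul (SmoothGerm a) :=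
  ⟨fun φ ψ => ⟨φ.1 * ψ.1, IsSmoothGerm.mul φ.2 ψ.2⟩⟩

/-- The value at `a` of a smooth germ at `a`. -/
def SmoothGerm.value {a : E} (φ : SmoothGerm a) : ℝ := Germ.value φ.1

/-- The `k`-th differential at `a` of a smooth germ at `a`, a bounded `k`-linear functional. -/
noncomputable def SmoothGerm.differential {a : E} (k : ℕ) (φ : SmoothGerm a) : E [×k]→L[ℝ] ℝ :=
  Germ.liftOn φ.1 (fun f => iteratedFDeriv ℝ k f a)
    (fun _ _ h => (EventuallyEq.iteratedFDeriv ℝ h k).eq_of_nhds)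

/-- An operational tangent vector to `E` at `a`: a linear functional on the space of germs at `a` of
smooth functions that satisfies the Leibniz rule. -/
structure OperationalTangentVector (a : E) extends SmoothGerm a →ₗ[ℝ] ℝ where
  leibniz : ∀ φ ψ : SmoothGerm a,
    toFun (φ * ψ) = toFun φ * SmoothGerm.value ψ + SmoothGerm.value φ * toFun ψ

/-- A bounded `n`-linear functional is symmetric if permuting the arguments does not change it. -/
def IsSymmetricForm {n : ℕ} (B : E [×n]→L[ℝ] ℝ) : Prop :=
  ∀ (σ : Equiv.Perm (Fin n)) (v : Fin n → E), B (v ∘ σ) = B v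

/-- `δ` is of order `n`: `δ f = ∑_{k=1}^n ℓ_k (f^{(k)}_a)` with continuous linear functionals `ℓ_k`
on the Banach spaces of bounded `k`-linear functionals, where `ℓ_n` does not vanish identically on
the symmetric `n`-linear functionals. -/
def OperationalTangentVector.HasOrder {a : E} (δ : OperationalTangentVector a) (n : ℕ) : Prop :=
  1 ≤ n ∧ ∃ ℓ : (k : ℕ) → ((E [×k]→L[ℝ] ℝ) →L[ℝ] ℝ),
    (∀ φ : SmoothGerm a,
      δ.toLinearMap φ = ∑ k ∈ Finset.Icc 1 n, ℓ k (SmoothGerm.differential k φ)) ∧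
    ∃ B : E [×n]→L[ℝ] ℝ, IsSymmetricForm B ∧ ℓ n B ≠ 0

end OperationalTangentVectors

/-! ### Second differentials of germs and the algebraic form of order two -/

section Calculus

variable {E : Type*} [NormedAddCommGroup E] [NormedSpace ℝ E]

/-! An order-two vector is governed by its second-order coefficient `T`, a continuous functional on
bounded bilinear forms. The Leibniz rule on products of functions vanishing at `a` forces `T` to
kill every symmetrized tensor product (`OperationalTangentVector.apply_symTensor`). Conversely, any
`T` that kills them defines a derivation through the second differential alone
(`OperationalTangentVector.ofBilinear`). So the question is whether such a `T` can be nonzero on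
symmetric forms.

For `2 < p < ∞` it cannot. Deleting finitely many coordinates changes a symmetric form only by
symmetrized tensors, which `T` ignores (`apply_comp_lpTail`), while the norms of the tails of the
form have infimum zero (`iInf_norm_tail_eq_zero`).

For `p ≤ 2` the `ℓ^2` inner product is a bounded form on `ℓ^p`. The diagonal limit minus the
iterated limit along the unit vectors kills symmetrized tensors but not this form. -/

theorem IsSmoothGerm.of_contDiff {a : E} {f : E → ℝ} (hf : ContDiff ℝ ∞ f) :
    IsSmoothGerm a (f : Germ (𝓝 a) ℝ) :=
  ⟨f, Set.univ, isOpen_univ, Set.mem_univ a, hf.contDiffOn, rfl⟩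

/-- Every smooth germ is represented by a function that is smooth at the base point. -/
theorem SmoothGerm.exists_rep {a : E} (φ : SmoothGerm a) :
    ∃ f : E → ℝ, ContDiffAt ℝ ∞ f a ∧ φ.1 = (f : Germ (𝓝 a) ℝ) := by
  obtain ⟨φ, f, U, hU, haU, hf, h⟩ := φ
  exact ⟨f, hf.contDiffAt (hU.mem_nhds haU), h⟩

theorem SmoothGerm.differential_eq {a : E} (k : ℕ) {φ : SmoothGerm a} {f : E → ℝ}
    (h : φ.1 = (f : Germ (𝓝 a) ℝ)) : SmoothGerm.differential k φ = iteratedFDeriv ℝ k f a := by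
  rw [SmoothGerm.differential, h]
  rfl

theorem SmoothGerm.value_eq {a : E} {φ : SmoothGerm a} {f : E → ℝ}
    (h : φ.1 = (f : Germ (𝓝 a) ℝ)) : SmoothGerm.value φ = f a := by
  rw [SmoothGerm.value, h]
  rfl

theorem SmoothGerm.mul_eq {a : E} {φ ψ : SmoothGerm a} {f g : E → ℝ}
    (hf : φ.1 = (f : Germ (𝓝 a) ℝ)) (hg : ψ.1 = (g : Germ (𝓝 a) ℝ)) :
    (φ * ψ).1 = ((f * g : E → ℝ) : Germ (𝓝 a) ℝ) := by
  change φ.1 * ψ.1 = _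
  rw [hf, hg]
  rfl

/-- The `k`-th differential as a linear map on smooth germs. -/
noncomputable def SmoothGerm.differentialₗ (a : E) (k : ℕ) :
    SmoothGerm a →ₗ[ℝ] (E [×k]→L[ℝ] ℝ) where
  toFun φ := SmoothGerm.differential k φ
  map_add' φ ψ := by
    obtain ⟨f, hf, hφ⟩ := SmoothGerm.exists_rep φ
    obtain ⟨g, hg, hψ⟩ := SmoothGerm.exists_rep ψ
    have h : (φ + ψ).1 = ((f + g : E → ℝ) : Germ (𝓝 a) ℝ) := by
      change φ.1 + ψ.1 = _
      rw [hφ, hψ]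
      rfl
    rw [differential_eq k hφ, differential_eq k hψ, differential_eq k h]
    exact iteratedFDeriv_add_apply (hf.of_le (by exact_mod_cast le_top))
      (hg.of_le (by exact_mod_cast le_top))
  map_smul' c φ := by
    obtain ⟨f, hf, hφ⟩ := SmoothGerm.exists_rep φ
    have h : (c • φ).1 = ((c • f : E → ℝ) : Germ (𝓝 a) ℝ) := by
      change c • φ.1 = _
      rw [hφ]
      rfl
    rw [differential_eq k hφ, differential_eq k h]
    exact iteratedFDeriv_const_smul_apply (hf.of_le (by exact_mod_cast le_top))

/-- The symmetrized tensor product of two continuous linear functionals. -/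
noncomputable def symTensor (ξ η : E →L[ℝ] ℝ) : E [×2]→L[ℝ] ℝ :=
  (ContinuousMultilinearMap.mkPiAlgebra ℝ (Fin 2) ℝ).compContinuousLinearMap ![ξ, η] +
    (ContinuousMultilinearMap.mkPiAlgebra ℝ (Fin 2) ℝ).compContinuousLinearMap ![η, ξ]

@[simp]
theorem symTensor_apply (ξ η : E →L[ℝ] ℝ) (m : Fin 2 → E) :
    symTensor ξ η m = ξ (m 0) * η (m 1) + η (m 0) * ξ (m 1) := by
  simp [symTensor, Fin.prod_univ_two]

/-- The symmetrized tensor of the first differentials is the only obstruction to the second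
differential being a derivation. -/
theorem iteratedFDeriv_two_mul {f g : E → ℝ} {a : E} (hf : ContDiffAt ℝ ∞ f a)
    (hg : ContDiffAt ℝ ∞ g a) :
    iteratedFDeriv ℝ 2 (f * g) a = f a • iteratedFDeriv ℝ 2 g a + g a • iteratedFDeriv ℝ 2 f a +
      symTensor (fderiv ℝ f a) (fderiv ℝ g a) := by
  have hev : fderiv ℝ (f * g) =ᶠ[𝓝 a] fun x => f x • fderiv ℝ g x + g x • fderiv ℝ f x := by
    have h1 := (hf.of_le (m := 1) (by exact_mod_cast le_top)).eventually (by simp)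
    have h2 := (hg.of_le (m := 1) (by exact_mod_cast le_top)).eventually (by simp)
    filter_upwards [h1, h2] with x hx hx'
    exact fderiv_mul (hx.differentiableAt (by simp)) (hx'.differentiableAt (by simp))
  have hf' : DifferentiableAt ℝ f a := hf.differentiableAt (by simp)
  have hg' : DifferentiableAt ℝ g a := hg.differentiableAt (by simp)
  have hf2 : DifferentiableAt ℝ (fderiv ℝ f) a :=
    (hf.fderiv_right (m := 1) (WithTop.coe_le_coe.2 (le_top (a := (1 + 1 : ℕ∞))))).differentiableAt (by simp)
  have hg2 : DifferentiableAt ℝ (fderiv ℝ g) a :=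
    (hg.fderiv_right (m := 1) (WithTop.coe_le_coe.2 (le_top (a := (1 + 1 : ℕ∞))))).differentiableAt (by simp)
  ext m
  have h := ((hf'.hasFDerivAt.smul hg2.hasFDerivAt).add
    (hg'.hasFDerivAt.smul hf2.hasFDerivAt)).congr_of_eventuallyEq hev
  rw [iteratedFDeriv_two_apply, h.fderiv]
  simp [iteratedFDeriv_two_apply]
  ring

variable (A : E →L[ℝ] E →L[ℝ] ℝ) (a : E)

theorem hasFDerivAt_quadratic (x : E) :
    HasFDerivAt (fun x => A (x - a) (x - a)) ((A + A.flip) (x - a)) x := by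
  have h1 : HasFDerivAt (fun x : E => x - a) (ContinuousLinearMap.id ℝ E) x :=
    (hasFDerivAt_id x).sub_const a
  have h := A.hasFDerivAt_of_bilinear h1 h1
  refine h.congr_fderiv ?_
  ext v
  simp

theorem contDiff_quadratic : ContDiff ℝ ∞ fun x => A (x - a) (x - a) := by
  have h1 : ContDiff ℝ ∞ fun x : E => x - a := contDiff_id.sub contDiff_const
  exact (A.contDiff.comp h1).clm_apply h1

theorem iteratedFDeriv_one_quadratic :
    iteratedFDeriv ℝ 1 (fun x => A (x - a) (x - a)) a = 0 := by
  ext m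
  rw [iteratedFDeriv_one_apply, (hasFDerivAt_quadratic A a a).fderiv]
  simp

theorem iteratedFDeriv_two_quadratic (m : Fin 2 → E) :
    iteratedFDeriv ℝ 2 (fun x => A (x - a) (x - a)) a m = A (m 0) (m 1) + A (m 1) (m 0) := by
  have h : fderiv ℝ (fun x => A (x - a) (x - a)) = fun x => (A + A.flip) (x - a) :=
    funext fun x => (hasFDerivAt_quadratic A a x).fderiv
  have h2 : HasFDerivAt (fun x => (A + A.flip) (x - a)) (A + A.flip) a := by
    exact (A + A.flip).hasFDerivAt.comp a ((hasFDerivAt_id a).sub_const a)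
  rw [iteratedFDeriv_two_apply, h, h2.fderiv]
  simp

variable {a}

theorem isSymmetricForm_two {B : E [×2]→L[ℝ] ℝ} (h : ∀ x y, B ![x, y] = B ![y, x]) :
    IsSymmetricForm B := by
  intro σ v
  have hσ : σ = 1 ∨ σ = Equiv.swap 0 1 := by
    revert σ
    decide
  obtain rfl | rfl := hσ
  · rfl
  · have h1 : v ∘ Equiv.swap 0 1 = ![v 1, v 0] := by
      ext i
      fin_cases i <;> simp
    have h2 : v = ![v 0, v 1] := by
      ext i
      fin_cases i <;> simp
    rw [h1, h, ← h2]

theorem IsSymmetricForm.apply_swap {B : E [×2]→L[ℝ] ℝ} (h : IsSymmetricForm B) (x y : E) :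
    B ![x, y] = B ![y, x] := by
  rw [← h (Equiv.swap 0 1) ![y, x]]
  congr 1
  ext i
  fin_cases i <;> simp

/-- The second-order part of an operational tangent vector of order two annihilates symmetrized
tensor products. -/
theorem OperationalTangentVector.apply_symTensor (δ : OperationalTangentVector a)
    {ℓ : (k : ℕ) → ((E [×k]→L[ℝ] ℝ) →L[ℝ] ℝ)}
    (h : ∀ φ : SmoothGerm a,
      δ.toLinearMap φ = ∑ k ∈ Finset.Icc 1 2, ℓ k (SmoothGerm.differential k φ))
    (ξ η : E →L[ℝ] ℝ) : ℓ 2 (symTensor ξ η) = 0 := by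
  have hs (ζ : E →L[ℝ] ℝ) : ContDiff ℝ ∞ fun x => ζ (x - a) :=
    ζ.contDiff.comp (contDiff_id.sub contDiff_const)
  let φ : SmoothGerm a := ⟨_, IsSmoothGerm.of_contDiff (hs ξ)⟩
  let ψ : SmoothGerm a := ⟨_, IsSmoothGerm.of_contDiff (hs η)⟩
  let A : E →L[ℝ] E →L[ℝ] ℝ := ξ.smulRight η
  have hφ : SmoothGerm.value φ = 0 := by
    rw [SmoothGerm.value_eq (φ := φ) rfl]
    simp
  have hψ : SmoothGerm.value ψ = 0 := by
    rw [SmoothGerm.value_eq (φ := ψ) rfl]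
    simp
  have hA : (φ * ψ).1 = ((fun x => A (x - a) (x - a) : E → ℝ) : Germ (𝓝 a) ℝ) :=
    SmoothGerm.mul_eq (φ := φ) (ψ := ψ) rfl rfl
  -- Both factors vanish at `a`, so each Leibniz term is zero.
  have hδ : δ.toLinearMap (φ * ψ) = 0 := by
    refine (δ.leibniz φ ψ).trans ?_
    rw [hφ, hψ]
    simp
  have h2 : SmoothGerm.differential 2 (φ * ψ) = symTensor ξ η := by
    ext m
    rw [SmoothGerm.differential_eq 2 hA, iteratedFDeriv_two_quadratic]
    simp [A, mul_comm]
  have h1 : SmoothGerm.differential 1 (φ * ψ) = 0 := by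
    rw [SmoothGerm.differential_eq 1 hA, iteratedFDeriv_one_quadratic]
  have h3 := h (φ * ψ)
  rw [hδ, show Finset.Icc 1 2 = {1, 2} from rfl, Finset.sum_pair (by norm_num), h1, h2, map_zero,
    zero_add] at h3
  exact h3.symm

/-- A continuous functional on bounded bilinear forms that annihilates symmetrized tensor products
induces an operational tangent vector. -/
noncomputable def OperationalTangentVector.ofBilinear (a : E) (T : (E [×2]→L[ℝ] ℝ) →L[ℝ] ℝ)
    (hT : ∀ ξ η : E →L[ℝ] ℝ, T (symTensor ξ η) = 0) : OperationalTangentVector a where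
  toLinearMap := T.toLinearMap ∘ₗ SmoothGerm.differentialₗ a 2
  leibniz φ ψ := by
    obtain ⟨f, hf, hφ⟩ := SmoothGerm.exists_rep φ
    obtain ⟨g, hg, hψ⟩ := SmoothGerm.exists_rep ψ
    change T (SmoothGerm.differential 2 (φ * ψ)) = T (SmoothGerm.differential 2 φ) * _ + _ * T (SmoothGerm.differential 2 ψ)
    rw [SmoothGerm.differential_eq 2 (SmoothGerm.mul_eq hφ hψ), SmoothGerm.differential_eq 2 hφ,
      SmoothGerm.differential_eq 2 hψ, SmoothGerm.value_eq hφ, SmoothGerm.value_eq hψ,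
      iteratedFDeriv_two_mul hf hg, map_add, map_add, map_smul, map_smul, hT]
    simp only [smul_eq_mul]
    ring

/-- If `T` does not vanish on the symmetrization of some bounded bilinear form, the tangent vector
that it induces has order two and is nonzero. -/
theorem OperationalTangentVector.ofBilinear_hasOrder_two (T : (E [×2]→L[ℝ] ℝ) →L[ℝ] ℝ)
    (hT : ∀ ξ η : E →L[ℝ] ℝ, T (symTensor ξ η) = 0) (A : E →L[ℝ] E →L[ℝ] ℝ)
    (hA : ∀ B : E [×2]→L[ℝ] ℝ, (∀ m, B m = A (m 0) (m 1) + A (m 1) (m 0)) → T B ≠ 0) :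
    (ofBilinear a T hT).HasOrder 2 ∧ (ofBilinear a T hT).toLinearMap ≠ 0 := by
  let φ : SmoothGerm a := ⟨_, IsSmoothGerm.of_contDiff (contDiff_quadratic A a)⟩
  have hφ (m : Fin 2 → E) : SmoothGerm.differential 2 φ m = A (m 0) (m 1) + A (m 1) (m 0) := by
    rw [SmoothGerm.differential_eq 2 (φ := φ) rfl, iteratedFDeriv_two_quadratic]
  have hne := hA _ hφ
  refine ⟨⟨by norm_num, fun | 2 => T | _ => 0, fun ψ => ?_, SmoothGerm.differential 2 φ,
    isSymmetricForm_two fun x y => ?_, hne⟩, fun h => hne ?_⟩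
  · rw [show Finset.Icc 1 2 = {1, 2} from rfl, Finset.sum_pair (by norm_num)]
    exact (zero_add _).symm
  · simp only [hφ]
    exact add_comm _ _
  · exact congrArg (fun L : SmoothGerm a →ₗ[ℝ] ℝ => L φ) h

end Calculus

/-! ### Diagonal and iterated limits of bilinear forms along an ultrafilter -/

section Ultralimit

theorem exists_tendsto_hyperfilter {f : ℕ → ℝ} {C : ℝ} (hf : ∀ n, |f n| ≤ C) :
    ∃ x, |x| ≤ C ∧ Tendsto f (hyperfilter ℕ : Filter ℕ) (𝓝 x) := by
  obtain ⟨x, hx, h⟩ := (isCompact_Icc (a := -C) (b := C)).ultrafilter_le_nhds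
    ((hyperfilter ℕ).map f)
    (tendsto_principal.2 (Eventually.of_forall fun n => abs_le.1 (hf n)))
  exact ⟨x, abs_le.2 hx, h⟩

/-- The limit of a sequence of real numbers along a fixed nonprincipal ultrafilter. -/
noncomputable def ultralimit (f : ℕ → ℝ) : ℝ := limUnder (hyperfilter ℕ : Filter ℕ) f

theorem ultralimit_eq {f : ℕ → ℝ} {x : ℝ} (h : Tendsto f (hyperfilter ℕ : Filter ℕ) (𝓝 x)) :
    ultralimit f = x :=
  h.limUnder_eq

theorem tendsto_ultralimit {f : ℕ → ℝ} {C : ℝ} (hf : ∀ n, |f n| ≤ C) :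
    Tendsto f (hyperfilter ℕ : Filter ℕ) (𝓝 (ultralimit f)) := by
  obtain ⟨x, -, hx⟩ := exists_tendsto_hyperfilter hf
  rwa [ultralimit_eq hx]

theorem abs_ultralimit_le {f : ℕ → ℝ} {C : ℝ} (hf : ∀ n, |f n| ≤ C) : |ultralimit f| ≤ C := by
  obtain ⟨x, h, hx⟩ := exists_tendsto_hyperfilter hf
  rwa [ultralimit_eq hx]

theorem ultralimit_add {f g : ℕ → ℝ} {C D : ℝ} (hf : ∀ n, |f n| ≤ C) (hg : ∀ n, |g n| ≤ D) :
    (ultralimit fun n => f n + g n) = ultralimit f + ultralimit g :=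
  ultralimit_eq ((tendsto_ultralimit hf).add (tendsto_ultralimit hg))

theorem ultralimit_mul {f g : ℕ → ℝ} {C D : ℝ} (hf : ∀ n, |f n| ≤ C) (hg : ∀ n, |g n| ≤ D) :
    (ultralimit fun n => f n * g n) = ultralimit f * ultralimit g :=
  ultralimit_eq ((tendsto_ultralimit hf).mul (tendsto_ultralimit hg))

@[simp]
theorem ultralimit_const (c : ℝ) : (ultralimit fun _ => c) = c :=
  ultralimit_eq tendsto_const_nhds

variable {E : Type*} [NormedAddCommGroup E] [NormedSpace ℝ E] {e : ℕ → E}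

theorem abs_apply_pair_le (B : E [×2]→L[ℝ] ℝ) {x y : E} (hx : ‖x‖ ≤ 1) (hy : ‖y‖ ≤ 1) :
    |B ![x, y]| ≤ ‖B‖ := by
  refine (B.le_opNorm _).trans ?_
  simp only [Fin.prod_univ_two, Matrix.cons_val_zero, Matrix.cons_val_one]
  exact mul_le_of_le_one_right (norm_nonneg _) (mul_le_one₀ hx (norm_nonneg _) hy)

/-- The limit of `B (e n) (e n)` along a nonprincipal ultrafilter, as a functional of `B`. -/
noncomputable def diagonalLimit (he : ∀ n, ‖e n‖ ≤ 1) : (E [×2]→L[ℝ] ℝ) →L[ℝ] ℝ :=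
  LinearMap.mkContinuous
    { toFun := fun B => ultralimit fun n => B ![e n, e n]
      map_add' := fun B C => ultralimit_add (fun n => abs_apply_pair_le B (he n) (he n))
        fun n => abs_apply_pair_le C (he n) (he n)
      map_smul' := fun c B => by
        have h := ultralimit_mul (f := fun _ => c) (fun _ => le_rfl)
          fun n => abs_apply_pair_le B (he n) (he n)
        rwa [ultralimit_const] at h }
    1 fun B => by
      rw [one_mul]
      exact abs_ultralimit_le fun n => abs_apply_pair_le B (he n) (he n)

/-- The iterated limit of `B (e n) (e m)` along a nonprincipal ultrafilter, as a functional
of `B`. -/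
noncomputable def iteratedLimit (he : ∀ n, ‖e n‖ ≤ 1) : (E [×2]→L[ℝ] ℝ) →L[ℝ] ℝ :=
  have hb (B : E [×2]→L[ℝ] ℝ) (n : ℕ) : |ultralimit fun m => B ![e n, e m]| ≤ ‖B‖ :=
    abs_ultralimit_le fun m => abs_apply_pair_le B (he n) (he m)
  LinearMap.mkContinuous
    { toFun := fun B => ultralimit fun n => ultralimit fun m => B ![e n, e m]
      map_add' := fun B C => by
        rw [← ultralimit_add (hb B) (hb C)]
        congr 1
        funext n
        exact ultralimit_add (fun m => abs_apply_pair_le B (he n) (he m))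
          fun m => abs_apply_pair_le C (he n) (he m)
      map_smul' := fun c B => by
        have h := ultralimit_mul (f := fun _ => c) (fun _ => le_rfl) (hb B)
        rw [ultralimit_const] at h
        refine Eq.trans ?_ h
        congr 1
        funext n
        have h' := ultralimit_mul (f := fun _ => c) (fun _ => le_rfl)
          fun m => abs_apply_pair_le B (he n) (he m)
        rwa [ultralimit_const] at h' }
    1 fun B => by
      rw [one_mul]
      exact abs_ultralimit_le (hb B)

theorem diagonalLimit_apply (he : ∀ n, ‖e n‖ ≤ 1) (B : E [×2]→L[ℝ] ℝ) :
    diagonalLimit he B = ultralimit fun n => B ![e n, e n] :=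
  rfl

theorem iteratedLimit_apply (he : ∀ n, ‖e n‖ ≤ 1) (B : E [×2]→L[ℝ] ℝ) :
    iteratedLimit he B = ultralimit fun n => ultralimit fun m => B ![e n, e m] :=
  rfl

/-- Ultralimits of bounded sequences are multiplicative, so on a product of functionals both limits
give the product of the separate limits. -/
theorem diagonalLimit_sub_iteratedLimit_symTensor (he : ∀ n, ‖e n‖ ≤ 1) (ξ η : E →L[ℝ] ℝ) :
    (diagonalLimit he - iteratedLimit he) (symTensor ξ η) = 0 := by
  have hb (ζ : E →L[ℝ] ℝ) (n : ℕ) : |ζ (e n)| ≤ ‖ζ‖ :=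
    (ζ.le_opNorm _).trans (mul_le_of_le_one_right (norm_nonneg _) (he n))
  have ht (ζ : E →L[ℝ] ℝ) := tendsto_ultralimit (hb ζ)
  have h1 : diagonalLimit he (symTensor ξ η) =
      ultralimit (fun n => ξ (e n)) * ultralimit (fun n => η (e n)) +
        ultralimit (fun n => η (e n)) * ultralimit (fun n => ξ (e n)) := by
    refine ultralimit_eq ?_
    simpa using ((ht ξ).mul (ht η)).add ((ht η).mul (ht ξ))
  have h2 (n : ℕ) : (ultralimit fun m => symTensor ξ η ![e n, e m]) =
      ξ (e n) * ultralimit (fun n => η (e n)) + η (e n) * ultralimit (fun n => ξ (e n)) := by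
    refine ultralimit_eq ?_
    simpa using ((ht η).const_mul _).add ((ht ξ).const_mul _)
  have h3 : iteratedLimit he (symTensor ξ η) =
      ultralimit (fun n => ξ (e n)) * ultralimit (fun n => η (e n)) +
        ultralimit (fun n => η (e n)) * ultralimit (fun n => ξ (e n)) := by
    rw [iteratedLimit_apply]
    simp only [h2]
    exact ultralimit_eq (((ht ξ).mul_const _).add ((ht η).mul_const _))
  rw [sub_apply, h1, h3, sub_self]

/-- For fixed `n` a nonprincipal ultrafilter ignores the single index `m = n`, so the iterated limit
vanishes and only the diagonal contributes. -/
theorem diagonalLimit_sub_iteratedLimit_of_orthogonal (he : ∀ n, ‖e n‖ ≤ 1) {B : E [×2]→L[ℝ] ℝ}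
    {c : ℝ} (h : ∀ n m, B ![e n, e m] = if n = m then c else 0) :
    (diagonalLimit he - iteratedLimit he) B = c := by
  have h2 (n : ℕ) : (ultralimit fun m => B ![e n, e m]) = 0 := by
    refine ultralimit_eq (tendsto_const_nhds.congr' ?_)
    filter_upwards [compl_mem_hyperfilter_of_finite (Set.finite_singleton n)] with m hm
    rw [h, if_neg fun hnm => hm hnm.symm]
  rw [sub_apply, diagonalLimit_apply, iteratedLimit_apply]
  simp only [h2]
  simp [h]

end Ultralimit

/-! ### Rank-one perturbations of the arguments of a form -/

section RankOne

variable {E : Type*} [NormedAddCommGroup E] [NormedSpace ℝ E]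

/-- A bilinear form with its first argument fixed. -/
noncomputable def applyLeft (B : E [×2]→L[ℝ] ℝ) (x : E) : E →L[ℝ] ℝ :=
  B.toContinuousLinearMap ![x, 0] 1

theorem applyLeft_apply (B : E [×2]→L[ℝ] ℝ) (x y : E) : applyLeft B x y = B ![x, y] := by
  change B (Function.update ![x, 0] 1 y) = _
  congr 1
  ext i
  fin_cases i <;> simp

/-- A bilinear form with its second argument fixed. -/
noncomputable def applyRight (B : E [×2]→L[ℝ] ℝ) (y : E) : E →L[ℝ] ℝ :=
  B.toContinuousLinearMap ![0, y] 0

theorem applyRight_apply (B : E [×2]→L[ℝ] ℝ) (x y : E) : applyRight B y x = B ![x, y] := by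
  change B (Function.update ![0, y] 0 x) = _
  congr 1
  ext i
  fin_cases i <;> simp

theorem comp_apply_pair (B : E [×2]→L[ℝ] ℝ) (Q : E →L[ℝ] E) (x y : E) :
    (B.compContinuousLinearMap fun _ => Q) ![x, y] = B ![Q x, Q y] := by
  rw [ContinuousMultilinearMap.compContinuousLinearMap_apply]
  congr 1
  ext i
  fin_cases i <;> simp

theorem norm_le_of_unit_ball {B : E [×2]→L[ℝ] ℝ} {C : ℝ}
    (h : ∀ x y, ‖x‖ ≤ 1 → ‖y‖ ≤ 1 → |B ![x, y]| ≤ C) : ‖B‖ ≤ C := by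
  have hC : 0 ≤ C := (abs_nonneg _).trans (h 0 0 (by simp) (by simp))
  refine B.opNorm_le_bound hC fun m => ?_
  have hn (x : E) : ‖‖x‖⁻¹ • x‖ ≤ 1 := by
    rw [norm_smul, norm_inv, norm_norm]
    exact inv_mul_le_one
  have hm (x : E) : ‖x‖ • ‖x‖⁻¹ • x = x := by
    by_cases hx : x = 0
    · simp [hx]
    · rw [smul_smul, mul_inv_cancel₀ (norm_ne_zero_iff.2 hx), one_smul]
  have h1 : m = fun i => ‖m i‖ • ![‖m 0‖⁻¹ • m 0, ‖m 1‖⁻¹ • m 1] i := by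
    funext i
    fin_cases i <;> exact (hm _).symm
  have h2 : B m = (∏ i, ‖m i‖) • B ![‖m 0‖⁻¹ • m 0, ‖m 1‖⁻¹ • m 1] := by
    rw [← B.map_smul_univ, ← h1]
  rw [h2, norm_smul, norm_prod, mul_comm]
  simp only [norm_norm]
  exact mul_le_mul_of_nonneg_right (h _ _ (hn _) (hn _)) (by positivity)

theorem IsSymmetricForm.comp {B : E [×2]→L[ℝ] ℝ} (hB : IsSymmetricForm B) (Q : E →L[ℝ] E) :
    IsSymmetricForm (B.compContinuousLinearMap fun _ => Q) := fun σ v =>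
  hB σ fun i => Q (v i)

/-- A linear functional that annihilates symmetrized tensor products does not see rank-one
perturbations of the identity in the arguments of a symmetric form. -/
theorem apply_comp_sub_rankOne {T : (E [×2]→L[ℝ] ℝ) →L[ℝ] ℝ}
    (hT : ∀ ξ η : E →L[ℝ] ℝ, T (symTensor ξ η) = 0) {B : E [×2]→L[ℝ] ℝ} (hB : IsSymmetricForm B)
    (ξ : E →L[ℝ] ℝ) (e : E) :
    T (B.compContinuousLinearMap fun _ => ContinuousLinearMap.id ℝ E - ξ.smulRight e) = T B := by
  let ψ : E →L[ℝ] ℝ := applyLeft B e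
  -- The factor one half compensates for `symTensor ξ ξ` being twice the square of `ξ`.
  have key : B.compContinuousLinearMap (fun _ => ContinuousLinearMap.id ℝ E - ξ.smulRight e) =
      B - symTensor ξ (ψ - (2⁻¹ * B ![e, e]) • ξ) := by
    ext m
    have hl (x x' y : E) (c : ℝ) : B ![x - c • x', y] = B ![x, y] - c * B ![x', y] := by
      simp only [← applyRight_apply, map_sub, map_smul, smul_eq_mul]
    have hr (x y y' : E) (c : ℝ) : B ![x, y - c • y'] = B ![x, y] - c * B ![x, y'] := by
      simp only [← applyLeft_apply, map_sub, map_smul, smul_eq_mul]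
    have h1 : (B.compContinuousLinearMap fun _ => ContinuousLinearMap.id ℝ E - ξ.smulRight e) m =
        B ![m 0 - ξ (m 0) • e, m 1 - ξ (m 1) • e] := by
      rw [ContinuousMultilinearMap.compContinuousLinearMap_apply]
      congr 1
      ext i
      fin_cases i <;> simp
    have h2 : B m = B ![m 0, m 1] := by
      congr 1
      ext i
      fin_cases i <;> simp
    rw [h1, hl, hr, hr, sub_apply, h2, symTensor_apply, hB.apply_swap (m 0) e]
    simp only [sub_apply, smul_apply, ψ, applyLeft_apply, smul_eq_mul]
    ring
  rw [key, map_sub, hT, sub_zero]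

end RankOne

/-! ### Tail projections on `ℓ^p` -/

section Lp

variable {p : ℝ≥0∞} [Fact (1 ≤ p)]

/-- The projection of `ℓ^p` that replaces the first `N` coordinates by zero. -/
noncomputable def lpTail (p : ℝ≥0∞) [Fact (1 ≤ p)] (N : ℕ) :
    lp (fun _ : ℕ => ℝ) p →L[ℝ] lp (fun _ : ℕ => ℝ) p :=
  ContinuousLinearMap.id ℝ _ - ∑ i ∈ Finset.range N,
    (lp.evalCLM ℝ (fun _ : ℕ => ℝ) p i).smulRight (lp.single (E := fun _ : ℕ => ℝ) p i 1)

theorem lpTail_eq (N : ℕ) (x : lp (fun _ : ℕ => ℝ) p) :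
    lpTail p N x = x - ∑ i ∈ Finset.range N, lp.single p i (x i) := by
  have h (i : ℕ) : lp.single (E := fun _ : ℕ => ℝ) p i (x i) = x i • lp.single p i 1 := by
    rw [← lp.single_smul, smul_eq_mul, mul_one]
  simp only [h]
  simp [lpTail, lp.evalCLM]

@[simp]
theorem lpTail_apply (N : ℕ) (x : lp (fun _ : ℕ => ℝ) p) (i : ℕ) :
    lpTail p N x i = if i < N then 0 else x i := by
  rw [lpTail_eq, lp.coeFn_sub, Pi.sub_apply, lp.coeFn_sum, Finset.sum_apply]
  simp only [lp.coeFn_single, Finset.sum_pi_single, Finset.mem_range]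
  split_ifs <;> simp

theorem lpTail_zero : lpTail p 0 = ContinuousLinearMap.id ℝ _ := by
  simp [lpTail]

/-- This factorization lets coordinates be removed one at a time by rank-one perturbations of the
identity. -/
theorem lpTail_succ (N : ℕ) : lpTail p (N + 1) = (lpTail p N).comp (ContinuousLinearMap.id ℝ _ -
    (lp.evalCLM ℝ (fun _ : ℕ => ℝ) p N).smulRight (lp.single (E := fun _ : ℕ => ℝ) p N 1)) := by
  ext x i
  have h : (ContinuousLinearMap.id ℝ (lp (fun _ : ℕ => ℝ) p) -
      (lp.evalCLM ℝ (fun _ : ℕ => ℝ) p N).smulRight (lp.single (E := fun _ : ℕ => ℝ) p N 1)) x =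
        x - x N • lp.single p N 1 := rfl
  rw [ContinuousLinearMap.comp_apply, h, lpTail_apply, lpTail_apply, lp.coeFn_sub, Pi.sub_apply,
    lp.coeFn_smul, Pi.smul_apply, lp.single_apply]
  rcases lt_trichotomy i N with hi | rfl | hi
  · simp [hi, hi.trans (Nat.lt_succ_self N)]
  · simp
  · simp [hi.not_gt, Pi.single_eq_of_ne hi.ne', show ¬ i < N + 1 by omega]

theorem tendsto_lpTail (hp : p ≠ ⊤) (x : lp (fun _ : ℕ => ℝ) p) :
    Tendsto (fun N => lpTail p N x) atTop (𝓝 0) := by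
  simp only [lpTail_eq]
  simpa using (lp.hasSum_single hp x).tendsto_sum_nat.const_sub x

/-- Two disjoint blocks of vectors in the unit ball of `ℓ^p` have a sum of norm at most `2 ^ p⁻¹`. -/
theorem norm_block_add_le (hp : p ≠ ⊤) (M : ℕ) {x y : lp (fun _ : ℕ => ℝ) p} (hx : ‖x‖ ≤ 1)
    (hy : ‖y‖ ≤ 1) : ‖(x - lpTail p M x) + lpTail p M y‖ ≤ 2 ^ p.toReal⁻¹ := by
  have hp0 : 0 < p.toReal := ENNReal.toReal_pos (zero_lt_one.trans_le Fact.out).ne' hp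
  have hs (z : lp (fun _ : ℕ => ℝ) p) := (lp.memℓp z).summable hp0
  have h1 (z : lp (fun _ : ℕ => ℝ) p) (hz : ‖z‖ ≤ 1) : ∑' i, ‖z i‖ ^ p.toReal ≤ 1 := by
    rw [← lp.norm_rpow_eq_tsum hp0]
    exact Real.rpow_le_one (norm_nonneg _) hz hp0.le
  refine lp.norm_le_of_tsum_le hp0 (by positivity) ?_
  rw [← Real.rpow_mul zero_le_two, inv_mul_cancel₀ hp0.ne', Real.rpow_one]
  calc _ ≤ ∑' i, (‖x i‖ ^ p.toReal + ‖y i‖ ^ p.toReal) := by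
        refine (hs _).tsum_le_tsum (fun i => ?_) ((hs x).add (hs y))
        rw [lp.coeFn_add, Pi.add_apply, lp.coeFn_sub, Pi.sub_apply, lpTail_apply, lpTail_apply]
        split_ifs
        · simpa using Real.rpow_nonneg (abs_nonneg (y i)) _
        · simpa using Real.rpow_nonneg (abs_nonneg (x i)) _
    _ ≤ 2 := by
        rw [(hs x).tsum_add (hs y)]
        linarith [h1 x hx, h1 y hy]

end Lp

/-! ### Decay of bilinear forms on tails, and the inclusion into `ℓ^2` -/

section Lp

variable {p : ℝ≥0∞} [Fact (1 ≤ p)]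

theorem lpTail_comp_lpTail {N M : ℕ} (h : N ≤ M) (x : lp (fun _ : ℕ => ℝ) p) :
    lpTail p N (lpTail p M x) = lpTail p M x := by
  ext i
  simp only [lpTail_apply]
  split_ifs <;> first | rfl | omega

/-- The norms of the restrictions of a bounded bilinear form on `ℓ^p` to two successive disjoint
blocks of coordinates are controlled by its norm on the union of the blocks. -/
theorem abs_block_add_norm_tail_le (hp : p ≠ ⊤) (B : lp (fun _ : ℕ => ℝ) p [×2]→L[ℝ] ℝ) {N M : ℕ}
    (hNM : N ≤ M) {u v : lp (fun _ : ℕ => ℝ) p} (hu : ‖u‖ ≤ 1) (hv : ‖v‖ ≤ 1) :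
    |(B.compContinuousLinearMap fun _ => lpTail p N) ![u - lpTail p M u, v - lpTail p M v]| +
      ‖B.compContinuousLinearMap fun _ => lpTail p M‖ ≤
    ((2 : ℝ) ^ p.toReal⁻¹) ^ 2 * ‖B.compContinuousLinearMap fun _ => lpTail p N‖ := by
  rw [← le_sub_iff_add_le']
  set C := B.compContinuousLinearMap fun _ => lpTail p N with hC
  have hM (x y : lp (fun _ : ℕ => ℝ) p) : (B.compContinuousLinearMap fun _ => lpTail p M) ![x, y] =
      C ![lpTail p M x, lpTail p M y] := by
    rw [hC, comp_apply_pair, comp_apply_pair, lpTail_comp_lpTail hNM, lpTail_comp_lpTail hNM]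
  have hle (x y : lp (fun _ : ℕ => ℝ) p) (hx : ‖x‖ ≤ 1) (hy : ‖y‖ ≤ 1) :
      |C ![(u - lpTail p M u) + lpTail p M x, (v - lpTail p M v) + lpTail p M y]| ≤
        ((2 : ℝ) ^ p.toReal⁻¹) ^ 2 * ‖C‖ := by
    refine (C.le_opNorm _).trans ?_
    rw [mul_comm, Fin.prod_univ_two, sq]
    gcongr
    · exact norm_block_add_le hp M hu hx
    · exact norm_block_add_le hp M hv hy
  have hadd (x y : lp (fun _ : ℕ => ℝ) p) (hx : ‖x‖ ≤ 1) (hy : ‖y‖ ≤ 1) :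
      |C ![u - lpTail p M u, v - lpTail p M v] + C ![lpTail p M x, lpTail p M y]| ≤
        ((2 : ℝ) ^ p.toReal⁻¹) ^ 2 * ‖C‖ := by
    have hl (a b c : lp (fun _ : ℕ => ℝ) p) : C ![a + b, c] = C ![a, c] + C ![b, c] := by
      simp only [← applyRight_apply, map_add]
    have hr (a b c : lp (fun _ : ℕ => ℝ) p) : C ![a, b + c] = C ![a, b] + C ![a, c] := by
      simp only [← applyLeft_apply, map_add]
    have hnl (a b : lp (fun _ : ℕ => ℝ) p) : C ![-a, b] = -C ![a, b] := by
      simp only [← applyRight_apply, map_neg]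
    have hnr (a b : lp (fun _ : ℕ => ℝ) p) : C ![a, -b] = -C ![a, b] := by
      simp only [← applyLeft_apply, map_neg]
    have h1 := abs_le.1 (hle x y hx hy)
    -- Averaging over the simultaneous sign change of `x` and `y` cancels the two cross terms.
    have h2 := abs_le.1 (hle (-x) (-y) (by rwa [norm_neg]) (by rwa [norm_neg]))
    simp only [map_neg, hl, hr, hnl, hnr, neg_neg] at h1 h2
    exact abs_le.2 ⟨by linarith, by linarith⟩
  refine norm_le_of_unit_ball fun x y hx hy => ?_
  have h1 := abs_le.1 (hadd x y hx hy)
  -- Flipping one sign turns the bound on the sum into a bound on the sum of absolute values.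
  have h2 := abs_le.1 (hadd (-x) y (by rwa [norm_neg]) hy)
  have h3 : C ![lpTail p M (-x), lpTail p M y] = -C ![lpTail p M x, lpTail p M y] := by
    simp only [← applyRight_apply, map_neg]
  rw [h3] at h2
  rw [hM, le_sub_iff_add_le']
  rcases abs_cases (C ![u - lpTail p M u, v - lpTail p M v]) with h | h <;>
    rcases abs_cases (C ![lpTail p M x, lpTail p M y]) with h' | h' <;> linarith

/-- A bounded bilinear form on `ℓ^p`, `2 < p < ∞`, is arbitrarily small on tails. -/
theorem iInf_norm_tail_eq_zero (h2 : 2 < p) (hp : p ≠ ⊤)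
    (B : lp (fun _ : ℕ => ℝ) p [×2]→L[ℝ] ℝ) :
    ⨅ N, ‖B.compContinuousLinearMap fun _ => lpTail p N‖ = 0 := by
  set c : ℕ → ℝ := fun N => ‖B.compContinuousLinearMap fun _ => lpTail p N‖ with hc
  set s : ℝ := ((2 : ℝ) ^ p.toReal⁻¹) ^ 2 with hs
  have hs0 : 0 < s := by positivity
  -- Here `s` is `2 ^ (2 / p)`, and `p > 2` is exactly what makes it less than two.
  have hs2 : s < 2 := by
    have hp2 : 2 < p.toReal := by
      simpa using (ENNReal.toReal_lt_toReal (by simp) hp).2 h2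
    rw [hs, ← Real.rpow_natCast, ← Real.rpow_mul zero_le_two]
    conv_rhs => rw [← Real.rpow_one 2]
    refine Real.rpow_lt_rpow_of_exponent_lt one_lt_two ?_
    rw [inv_mul_lt_iff₀ (by linarith)]
    simpa using hp2
  have hbdd : BddBelow (Set.range c) := ⟨0, by rintro _ ⟨N, rfl⟩; exact norm_nonneg _⟩
  have h0 : 0 ≤ ⨅ N, c N := le_ciInf fun N => norm_nonneg _
  -- As `M` grows, the blocks `u - lpTail p M u` and `v - lpTail p M v` tend to `u` and `v`, so the
  -- block bound passes to the full norm.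
  have key (N : ℕ) : c N + ⨅ M, c M ≤ s * c N := by
    rw [← le_sub_iff_add_le]
    refine norm_le_of_unit_ball fun u v hu hv => ?_
    rw [le_sub_iff_add_le]
    have ht (x : lp (fun _ : ℕ => ℝ) p) : Tendsto (fun M => x - lpTail p M x) atTop (𝓝 x) := by
      simpa using (tendsto_lpTail hp x).const_sub x
    have hpair : Tendsto (fun M => ![u - lpTail p M u, v - lpTail p M v]) atTop (𝓝 ![u, v]) :=
      tendsto_pi_nhds.2 fun i => by fin_cases i <;> simpa using ht _
    refine le_of_tendsto ((((B.compContinuousLinearMap fun _ => lpTail p N).cont.tendsto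
      _).comp hpair).abs.add_const _) ?_
    filter_upwards [eventually_ge_atTop N] with M hM
    exact (add_le_add_right (ciInf_le hbdd M) _).trans
      (abs_block_add_norm_tail_le hp B hM hu hv)
  -- Taking the infimum in `key` shows that twice the infimum is at most `s` times it; since `s <
  -- 2`, it is zero.
  have h3 : 2 * (⨅ N, c N) / s ≤ ⨅ N, c N := le_ciInf fun N => by
    rw [div_le_iff₀ hs0]
    have := ciInf_le hbdd N
    linarith [key N]
  rw [div_le_iff₀ hs0] at h3
  nlinarith

theorem apply_comp_lpTail {T : (lp (fun _ : ℕ => ℝ) p [×2]→L[ℝ] ℝ) →L[ℝ] ℝ}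
    (hT : ∀ ξ η, T (symTensor ξ η) = 0) {B : lp (fun _ : ℕ => ℝ) p [×2]→L[ℝ] ℝ}
    (hB : IsSymmetricForm B) (N : ℕ) :
    T (B.compContinuousLinearMap fun _ => lpTail p N) = T B := by
  induction N with
  | zero =>
    rw [lpTail_zero]
    rfl
  | succ N ih =>
    rw [lpTail_succ, ← ih]
    exact apply_comp_sub_rankOne hT (hB.comp (lpTail p N)) (lp.evalCLM ℝ (fun _ : ℕ => ℝ) p N)
      (lp.single p N 1)

theorem apply_eq_zero_of_symTensor (h2 : 2 < p) (hp : p ≠ ⊤)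
    {T : (lp (fun _ : ℕ => ℝ) p [×2]→L[ℝ] ℝ) →L[ℝ] ℝ} (hT : ∀ ξ η, T (symTensor ξ η) = 0)
    {B : lp (fun _ : ℕ => ℝ) p [×2]→L[ℝ] ℝ} (hB : IsSymmetricForm B) : T B = 0 := by
  rw [← norm_le_zero_iff]
  calc ‖T B‖ ≤ ⨅ N, ‖T‖ * ‖B.compContinuousLinearMap fun _ => lpTail p N‖ :=
        le_ciInf fun N => by
          rw [← apply_comp_lpTail hT hB N]
          exact T.le_opNorm _
    _ = 0 := by
        rw [← Real.mul_iInf_of_nonneg (norm_nonneg T), iInf_norm_tail_eq_zero h2 hp, mul_zero]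

/-- The inclusion of `ℓ^p` into `ℓ^2` for `p ≤ 2`, as a continuous linear map. -/
noncomputable def lpInclusionTwo (h : p ≤ 2) :
    lp (fun _ : ℕ => ℝ) p →L[ℝ] lp (fun _ : ℕ => ℝ) 2 :=
  ⟨lp.linearMapOfLE ℝ (fun _ : ℕ => ℝ) h, by
    -- By the closed graph theorem it is enough that coordinates are continuous on both spaces.
    refine LinearMap.continuous_of_seq_closed_graph _ fun u x y hx hy => ?_
    ext i
    have h1 := ((lp.evalCLM ℝ (fun _ : ℕ => ℝ) p i).continuous.tendsto x).comp hx
    have h2 := ((lp.evalCLM ℝ (fun _ : ℕ => ℝ) 2 i).continuous.tendsto y).comp hy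
    exact tendsto_nhds_unique h2 h1⟩

end Lp

theorem proposition1 (p : ℝ≥0∞) [Fact (1 ≤ p)] (a : lp (fun _ : ℕ => ℝ) p) :
    (2 < p → p < ⊤ → ¬ ∃ δ : OperationalTangentVector a, δ.HasOrder 2) ∧
    (p ≤ 2 → ∃ δ : OperationalTangentVector a, δ.HasOrder 2 ∧ δ.toLinearMap ≠ 0) := by
  refine ⟨?_, fun hp => ?_⟩
  · rintro h2 hp ⟨δ, -, ℓ, hℓ, B, hB, hne⟩
    exact hne (apply_eq_zero_of_symTensor h2 hp.ne (δ.apply_symTensor hℓ) hB)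
  · let e : ℕ → lp (fun _ : ℕ => ℝ) p := fun n => lp.single p n 1
    have he (n : ℕ) : ‖e n‖ ≤ 1 := by
      simp [e, lp.norm_single (E := fun _ : ℕ => ℝ) (zero_lt_one.trans_le (Fact.out : 1 ≤ p))]
    let J := lpInclusionTwo hp
    let A : lp (fun _ : ℕ => ℝ) p →L[ℝ] lp (fun _ : ℕ => ℝ) p →L[ℝ] ℝ :=
      (innerSL ℝ).bilinearComp J J
    have hJ (n : ℕ) : J (e n) = lp.single 2 n 1 := by
      ext i
      rfl
    have hA (n m : ℕ) : A (e n) (e m) = if n = m then 1 else 0 := by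
      change inner ℝ (J (e n)) (J (e m)) = _
      rw [hJ, hJ, lp.inner_single_left, lp.single_apply, Pi.single_apply]
      split_ifs <;> simp
    refine ⟨_, OperationalTangentVector.ofBilinear_hasOrder_two _
      (diagonalLimit_sub_iteratedLimit_symTensor he) A fun B hB => ?_⟩
    -- The constant is two because `B` symmetrizes `A` without halving.
    rw [diagonalLimit_sub_iteratedLimit_of_orthogonal he (c := 2)]
    · exact two_ne_zero
    · intro n m
      rw [hB]
      simp only [Matrix.cons_val_zero, Matrix.cons_val_one, hA, eq_comm (a := m)]
      split_ifs <;> norm_num
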